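/- Let $n\ge 1$ and let $\delta:[0,\infty)\to\mathbb{R}$ be a $C^1$ non-increasing function with $\delta'(0)=0$. Consider $\mathbb{R}^{n+1}$ with the radial weight $e^{\psi}$, where $\psi(x):=\delta(|x|)$. Let $\Sigma$ be a smooth, connected, two-sided (immersed) hypersurface in $\mathbb{R}^{n+1}$, possibly with smooth boundary $\partial\Sigma$, with smooth unit normal $N$ and the induced metric. For a vector field $X$ of $\mathbb{R}^{n+1}$ along $\Sigma$ put $\operatorname{div}_{\Sigma,\psi}X:=\operatorname{div}_\Sigma X+\langle\nabla\psi,X\rangle$, and for $u\in C^2(\Sigma)$ put $\Delta_{\Sigma,\psi}u:=\operatorname{div}_{\Sigma,\psi}(\nabla_\Sigma u)$. Let $\nu$ denote the inner unit conormal of $\Sigma$ along $\partial\Sigma$ (the unit vector tangent to $\Sigma$, normal to $\partial\Sigma$ and pointing into $\Sigma$). Suppose that * $\Sigma$ is $\psi$-minimal, i.e. $H_\psi:=-\operatorname{div}_{\Sigma,\psi}N=0$ on $\Sigma$; * $\Sigma$ is $\psi$-parabolic, i.e. every $u\in C^2(\Sigma)$ that is bounded from above and satisfies $\Delta_{\Sigma,\psi}u\ge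 0$ on $\Sigma\setminus\partial\Sigma$ and $\partial u/\partial\nu\ge 0$ along $\partial\Sigma$ is constant; * $\Sigma\subseteq F$ for a closed half-space $F\subset\mathbb{R}^{n+1}$ with $0\in\partial F$, and $\langle\eta,\nu\rangle\ge 0$ along $\partial\Sigma$, where $\eta$ is the unit normal to $\partial F$ pointing outside $F$. Then $\Sigma$ is contained in a hyperplane parallel to $\partial F$. Moreover, if $\psi$ is non-constant on $\Sigma$, then $\Sigma\subseteq\partial F$. -/

import Mathlib

open scoped Manifold ContDiff InnerProductSpace

noncomputable section

namespace WeightedHypersurface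

/-- The Euclidean space `ℝⁿ⁺¹`. -/
abbrev Amb (n : ℕ) : Type := EuclideanSpace ℝ (Fin (n + 1))

/-- The closed half-space `{x | ⟨x, η⟩ ≤ c}`; if `η` is a unit vector then `η` is the unit normal to
its boundary that points outside it. -/
def closedHalfSpace {n : ℕ} (η : Amb n) (c : ℝ) : Set (Amb n) := {x | ⟪x, η⟫_ℝ ≤ c}

/-- The hyperplane `{x | ⟨x, η⟩ = a}`. -/
def hyperplane {n : ℕ} (η : Amb n) (a : ℝ) : Set (Amb n) := {x | ⟪x, η⟫_ℝ = a}

/-- The radial function `ψ(x) = δ(|x|)`. -/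
def radial {n : ℕ} (δ : ℝ → ℝ) (x : Amb n) : ℝ := δ ‖x‖

/-! A hypersurface (possibly with boundary) is an `n`-manifold `M` modelled on the closed half-space
of `ℝⁿ`, with a smooth immersion `f : M → ℝⁿ⁺¹`, which is the inclusion map in the embedded case.
The metric of `M` is the one induced by `f`. Vectors tangent to the hypersurface at `p` are the
elements of the range of the differential of `f` at `p`. -/

variable {n : ℕ} [NeZero n] {M : Type*} [TopologicalSpace M]
  [ChartedSpace (EuclideanHalfSpace n) M]

/-- The derivative at `p` of a vector-valued function on `M` in the direction of a tangent vector `v`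
of `M` at `p`, which is read in the preferred chart at `p`. -/
def dirDeriv {F : Type*} [NormedAddCommGroup F] [NormedSpace ℝ F]
    (X : M → F) (p : M) (v : EuclideanSpace ℝ (Fin n)) : F :=
  mfderiv (𝓡∂ n) 𝓘(ℝ, F) X p v

/-- The derivative in the direction of the `i`-th coordinate vector of the preferred chart. -/
def partialDeriv {F : Type*} [NormedAddCommGroup F] [NormedSpace ℝ F]
    (X : M → F) (p : M) (i : Fin n) : F :=
  dirDeriv X p (EuclideanSpace.single i (1 : ℝ))

/-- `f` is a smooth immersion of `M` in `ℝⁿ⁺¹`. -/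
structure IsHypersurface (f : M → Amb n) : Prop where
  smooth : ContMDiff (𝓡∂ n) 𝓘(ℝ, Amb n) ∞ f
  injective_dirDeriv : ∀ p : M,
    Function.Injective fun v : EuclideanSpace ℝ (Fin n) => dirDeriv f p v

/-- `N` is a Gauss map: a globally defined smooth unit normal along `f`. -/
structure IsGaussMap (f N : M → Amb n) : Prop where
  smooth : ContMDiff (𝓡∂ n) 𝓘(ℝ, Amb n) ∞ N
  norm_eq_one : ∀ p : M, ‖N p‖ = 1
  normal : ∀ (p : M) (v : EuclideanSpace ℝ (Fin n)), ⟪dirDeriv f p v, N p⟫_ℝ = 0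

/-- The matrix `g_{ij} = ⟨∂ᵢ f, ∂ⱼ f⟩` of the induced metric at `p`. -/
def gram (f : M → Amb n) (p : M) : Matrix (Fin n) (Fin n) ℝ :=
  Matrix.of fun i j => ⟪partialDeriv f p i, partialDeriv f p j⟫_ℝ

/-- The gradient `∇_Σ u = ∑ gⁱʲ (∂ⱼ u) ∂ᵢ f`, as a vector field of `ℝⁿ⁺¹` along the hypersurface. -/
def surfGrad (f : M → Amb n) (u : M → ℝ) (p : M) : Amb n :=
  ∑ i, ∑ j, ((gram f p)⁻¹ i j * partialDeriv u p j) • partialDeriv f p i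

/-- The divergence `div_Σ X = ∑ gⁱʲ ⟨∂ᵢ X, ∂ⱼ f⟩` of a vector field `X` of `ℝⁿ⁺¹` along the
hypersurface, not necessarily tangent to it: the trace over the tangent space of `v ↦ D_v X`. -/
def surfDiv (f X : M → Amb n) (p : M) : ℝ :=
  ∑ i, ∑ j, (gram f p)⁻¹ i j * ⟪partialDeriv X p i, partialDeriv f p j⟫_ℝ

/-- The `ψ`-divergence `div_{Σ,ψ} X = div_Σ X + ⟨∇ψ, X⟩`. -/
def weightedDiv (ψ : Amb n → ℝ) (f X : M → Amb n) (p : M) : ℝ :=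
  surfDiv f X p + ⟪gradient ψ (f p), X p⟫_ℝ

/-- The `ψ`-Laplacian `Δ_{Σ,ψ} u = div_{Σ,ψ} (∇_Σ u)`. -/
def weightedLaplacian (ψ : Amb n → ℝ) (f : M → Amb n) (u : M → ℝ) (p : M) : ℝ :=
  weightedDiv ψ f (surfGrad f u) p

/-- The `ψ`-mean curvature `H_ψ = -div_{Σ,ψ} N`. -/
def weightedMeanCurvature (ψ : Amb n → ℝ) (f N : M → Amb n) (p : M) : ℝ :=
  -weightedDiv ψ f N p

/-- `ψ`-minimality. -/
def IsWeightedMinimal (ψ : Amb n → ℝ) (f N : M → Amb n) : Prop :=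
  ∀ p : M, weightedMeanCurvature ψ f N p = 0

/-- `ν` is the inner unit conormal at the boundary point `p`: the unit vector tangent to the
hypersurface, orthogonal to its boundary, and pointing into it. The preferred chart at `p` takes values
in `{x | 0 ≤ x 0}`, so the tangent vectors of `M` at `p` that are tangent to the boundary are those with
vanishing `0`-th coordinate, and those that point inwards have a positive one. -/
def IsInnerConormal (f : M → Amb n) (p : M) (ν : Amb n) : Prop :=
  ‖ν‖ = 1 ∧
  (∃ v : EuclideanSpace ℝ (Fin n), 0 < v 0 ∧ dirDeriv f p v = ν) ∧
  ∀ w : EuclideanSpace ℝ (Fin n), w 0 = 0 → ⟪dirDeriv f p w, ν⟫_ℝ = 0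

/-- `ψ`-parabolicity: every `C²` function on the hypersurface that is bounded from above,
`ψ`-subharmonic away from the boundary and with `∂u/∂ν = ⟨∇_Σ u, ν⟩ ≥ 0` along the boundary is
constant. -/
def IsWeightedParabolic (ψ : Amb n → ℝ) (f : M → Amb n) : Prop :=
  ∀ u : M → ℝ, ContMDiff (𝓡∂ n) 𝓘(ℝ, ℝ) 2 u → BddAbove (Set.range u) →
    (∀ p ∈ (𝓡∂ n).interior M, 0 ≤ weightedLaplacian ψ f u p) →
    (∀ p ∈ (𝓡∂ n).boundary M, ∀ ν : Amb n, IsInnerConormal f p ν → 0 ≤ ⟪surfGrad f u p, ν⟫_ℝ) →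
    ∃ a : ℝ, ∀ p : M, u p = a

end WeightedHypersurface

end

open scoped Manifold ContDiff InnerProductSpace

namespace WeightedHypersurface

section HalfSpace

variable {n : ℕ}

/-! Apply parabolicity to the height `u = ⟪f, η⟫`, which is at most `0` on the half-space. Its
surface gradient is the tangential part of `η`, so minimality gives `Δ u = ⟪∇ψ, η⟫`
(`weightedLaplacian_inner_const`). Since `∇ψ = (δ'(|x|)/|x|) x` with `δ' ≤ 0`, this is nonnegative
where `⟪x, η⟫ ≤ 0` (`inner_gradient_radial_nonneg`). The conormal derivative is `⟪η, ν⟫ ≥ 0`, hence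
`u` is a constant `a`. If `a ≠ 0`, the surface avoids the origin and `0 = Δ u = δ'(|f|) a / |f|`
forces `δ' = 0` at all its norms. By connectedness `ψ` is then constant on it
(`radial_eq_of_deriv_eq_zero`). -/

theorem frontier_closedHalfSpace {η : Amb n} (hη : ‖η‖ = 1) (c : ℝ) :
    frontier (closedHalfSpace η c) = hyperplane η c := by
  have hsurj : Function.Surjective (innerSL ℝ η) := fun t =>
    ⟨t • η, by simp [hη]⟩
  have hopen : IsOpenMap (innerSL ℝ η) := ContinuousLinearMap.isOpenMap _ hsurj
  have h := hopen.preimage_frontier_eq_frontier_preimage (innerSL ℝ η).continuous (Set.Iic c)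
  have hset : closedHalfSpace η c = innerSL ℝ η ⁻¹' Set.Iic c := by
    ext x
    simp [closedHalfSpace, real_inner_comm]
  rw [hset, ← h, frontier_Iic]
  ext x
  simp [hyperplane, real_inner_comm]

end HalfSpace

/-! ### Calculus of the radial weight. -/

section Radial

variable {n : ℕ} {δ : ℝ → ℝ}

theorem hasGradientAt_radial_of_ne_zero (hδ : ContDiffOn ℝ 1 δ (Set.Ici 0)) {x : Amb n}
    (hx : x ≠ 0) : HasGradientAt (radial δ) ((deriv δ ‖x‖ / ‖x‖) • x) x := by
  have hpos : 0 < ‖x‖ := norm_pos_iff.2 hx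
  have hd : HasDerivAt δ (deriv δ ‖x‖) ‖x‖ :=
    ((hδ.differentiableOn one_ne_zero ‖x‖ hpos.le).differentiableAt
      (Ici_mem_nhds hpos)).hasDerivAt
  have hsq : HasFDerivAt (fun y : Amb n => ‖y‖ ^ 2) (2 • innerSL ℝ x) x :=
    (hasStrictFDerivAt_norm_sq x).hasFDerivAt
  have hnorm : HasFDerivAt (fun y : Amb n => ‖y‖) (‖x‖⁻¹ • innerSL ℝ x) x := by
    have h := hsq.sqrt (by positivity)
    simp only [Real.sqrt_sq (norm_nonneg _)] at h
    refine h.congr_fderiv (ContinuousLinearMap.ext fun v => ?_)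
    simp only [smul_apply, smul_eq_mul, nsmul_eq_mul]
    field_simp
    norm_num
  have h := hd.comp_hasFDerivAt x hnorm
  rw [hasGradientAt_iff_hasFDerivAt]
  refine h.congr_fderiv (ContinuousLinearMap.ext fun v => ?_)
  simp only [smul_apply, smul_eq_mul, InnerProductSpace.toDual_apply_apply,
    real_inner_smul_left, innerSL_apply_apply]
  ring

/-- The norm is not differentiable at the origin, so the chain rule fails there; the vanishing
one-sided derivative gives `δ(|y|) - δ(0) = o(|y|)` instead. -/
theorem hasGradientAt_radial_zero (hδ : ContDiffOn ℝ 1 δ (Set.Ici 0))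
    (hδ_zero : derivWithin δ (Set.Ici 0) 0 = 0) :
    HasGradientAt (radial δ) 0 (0 : Amb n) := by
  have hd : HasDerivWithinAt δ 0 (Set.Ici 0) 0 := by
    have h := (hδ.differentiableOn one_ne_zero 0 Set.self_mem_Ici).hasDerivWithinAt
    rwa [hδ_zero] at h
  have ho := hasDerivWithinAt_iff_isLittleO.1 hd
  have ht : Filter.Tendsto (fun y : Amb n => ‖y‖) (nhds 0) (nhdsWithin 0 (Set.Ici 0)) :=
    tendsto_nhdsWithin_iff.2 ⟨tendsto_norm_zero, Filter.Eventually.of_forall norm_nonneg⟩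
  have h := ho.comp_tendsto ht
  rw [hasGradientAt_iff_hasFDerivAt, hasFDerivAt_iff_isLittleO]
  rw [← Asymptotics.isLittleO_norm_right]
  simpa [Function.comp_def, radial] using h

theorem deriv_nonpos_of_antitoneOn_Ici (hδ_anti : AntitoneOn δ (Set.Ici 0)) {t : ℝ} (ht : 0 < t) :
    deriv δ t ≤ 0 := by
  rw [← derivWithin_of_mem_nhds (Ici_mem_nhds ht)]
  exact hδ_anti.derivWithin_nonpos

theorem inner_gradient_radial_nonneg (hδ : ContDiffOn ℝ 1 δ (Set.Ici 0))
    (hδ_anti : AntitoneOn δ (Set.Ici 0)) (hδ_zero : derivWithin δ (Set.Ici 0) 0 = 0)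
    {x η : Amb n} (hx : ⟪x, η⟫_ℝ ≤ 0) : 0 ≤ ⟪gradient (radial δ) x, η⟫_ℝ := by
  rcases eq_or_ne x 0 with rfl | h0
  · simp [(hasGradientAt_radial_zero (n := n) hδ hδ_zero).gradient]
  · rw [(hasGradientAt_radial_of_ne_zero hδ h0).gradient, real_inner_smul_left]
    exact mul_nonneg_of_nonpos_of_nonpos (div_nonpos_of_nonpos_of_nonneg
      (deriv_nonpos_of_antitoneOn_Ici hδ_anti (norm_pos_iff.2 h0)) (norm_nonneg x)) hx

/-- A function with vanishing derivative along the norms of a connected family of nonzero vectors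
is constant on these norms. -/
theorem radial_eq_of_deriv_eq_zero {M : Type*} [TopologicalSpace M] [ConnectedSpace M]
    (hδ : ContDiffOn ℝ 1 δ (Set.Ici 0)) {f : M → Amb n} (hf : Continuous f)
    (h0 : ∀ p, f p ≠ 0) (hderiv : ∀ p, deriv δ ‖f p‖ = 0) (p q : M) :
    radial δ (f p) = radial δ (f q) := by
  -- By connectedness the norms fill an interval, on which the mean value inequality applies.
  have hconv : Convex ℝ (Set.range fun p => ‖f p‖) :=
    (isPreconnected_range hf.norm).ordConnected.convex
  have hd : ∀ t ∈ Set.range fun p => ‖f p‖,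
      HasDerivWithinAt δ 0 (Set.range fun p => ‖f p‖) t := by
    rintro _ ⟨r, rfl⟩
    have hpos : 0 < ‖f r‖ := norm_pos_iff.2 (h0 r)
    have h := ((hδ.differentiableOn one_ne_zero ‖f r‖ hpos.le).differentiableAt
      (Ici_mem_nhds hpos)).hasDerivAt
    rw [hderiv r] at h
    exact h.hasDerivWithinAt
  have h := hconv.norm_image_sub_le_of_norm_hasDerivWithin_le (C := 0) hd (by simp)
    (Set.mem_range_self q) (Set.mem_range_self p)
  simpa [sub_eq_zero, radial] using h

end Radial

/-! ### Geometry of the height function on the hypersurface. -/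

section Surface

variable {n : ℕ} [NeZero n] {M : Type*} [TopologicalSpace M]
  [ChartedSpace (EuclideanHalfSpace n) M]

theorem dirDeriv_comp {E F : Type*} [NormedAddCommGroup E] [NormedSpace ℝ E]
    [NormedAddCommGroup F] [NormedSpace ℝ F] {G : E → F} {X : M → E} {p : M} {G' : E →L[ℝ] F}
    (hG : HasFDerivAt G G' (X p)) (hX : MDifferentiableAt (𝓡∂ n) 𝓘(ℝ, E) X p)
    (v : EuclideanSpace ℝ (Fin n)) :
    dirDeriv (fun q => G (X q)) p v = G' (dirDeriv X p v) := by
  have h := (hG.hasMFDerivAt.comp p hX.hasMFDerivAt).mfderiv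
  exact congrArg (fun L => L v) h

theorem dirDeriv_inner_const {X : M → Amb n} {p : M}
    (hX : MDifferentiableAt (𝓡∂ n) 𝓘(ℝ, Amb n) X p) (η : Amb n)
    (v : EuclideanSpace ℝ (Fin n)) :
    dirDeriv (fun q => ⟪X q, η⟫_ℝ) p v = ⟪dirDeriv X p v, η⟫_ℝ := by
  have h := dirDeriv_comp (G := innerSL ℝ η) (innerSL ℝ η).hasFDerivAt hX v
  simpa only [innerSL_apply_apply, real_inner_comm] using h

theorem partialDeriv_inner_const {X : M → Amb n} {p : M}
    (hX : MDifferentiableAt (𝓡∂ n) 𝓘(ℝ, Amb n) X p) (η : Amb n) (i : Fin n) :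
    partialDeriv (fun q => ⟪X q, η⟫_ℝ) p i = ⟪partialDeriv X p i, η⟫_ℝ :=
  dirDeriv_inner_const hX η _

theorem partialDeriv_const {F : Type*} [NormedAddCommGroup F] [NormedSpace ℝ F]
    (a : F) (p : M) (i : Fin n) : partialDeriv (fun _ : M => a) p i = 0 := by
  have h : mfderiv (𝓡∂ n) 𝓘(ℝ, F) (fun _ : M => a) p = 0 := mfderiv_const
  exact congrArg (fun L => L (EuclideanSpace.single i (1 : ℝ))) h

/-- The derivative of the tangential part `η - ⟨η, N⟩ N` of a constant vector `η`. -/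
theorem partialDeriv_tangential {N : M → Amb n} {p : M}
    (hN : MDifferentiableAt (𝓡∂ n) 𝓘(ℝ, Amb n) N p) (η : Amb n) (i : Fin n) :
    partialDeriv (fun q => η - ⟪η, N q⟫_ℝ • N q) p i =
      -(⟪η, N p⟫_ℝ • partialDeriv N p i + ⟪η, partialDeriv N p i⟫_ℝ • N p) := by
  have hG : HasFDerivAt (fun y : Amb n => η - innerSL ℝ η y • y)
      (-(innerSL ℝ η (N p) • ContinuousLinearMap.id ℝ (Amb n) +
        (innerSL ℝ η).smulRight (N p))) (N p) :=
    ((innerSL ℝ η).hasFDerivAt.smul (hasFDerivAt_id (N p))).const_sub η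
  exact dirDeriv_comp hG hN _

theorem linearIndependent_partialDeriv {f : M → Amb n} (hf : IsHypersurface f) (p : M) :
    LinearIndependent ℝ (fun i : Fin n => partialDeriv f p i) := by
  have hli := (EuclideanSpace.basisFun (Fin n) ℝ).toBasis.linearIndependent
  let L : EuclideanSpace ℝ (Fin n) →ₗ[ℝ] Amb n := (mfderiv (𝓡∂ n) 𝓘(ℝ, Amb n) f p).toLinearMap
  have h := hli.map' L (LinearMap.ker_eq_bot.2 (hf.injective_dirDeriv p))
  have hL : L ∘ (EuclideanSpace.basisFun (Fin n) ℝ).toBasis = fun i => partialDeriv f p i := by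
    funext i
    rw [Function.comp_apply, OrthonormalBasis.coe_toBasis, EuclideanSpace.basisFun_apply]
    rfl
  rwa [hL] at h

theorem isUnit_det_gram {f : M → Amb n} (hf : IsHypersurface f) (p : M) :
    IsUnit (gram f p).det := by
  have h : (Matrix.gram ℝ (fun i : Fin n => partialDeriv f p i)).PosDef :=
    Matrix.posDef_gram_of_linearIndependent (linearIndependent_partialDeriv hf p)
  exact (Matrix.isUnit_iff_isUnit_det _).1 h.isUnit

/-- The coordinate vectors and the unit normal span the ambient space. -/
theorem eq_zero_of_inner_eq_zero {f N : M → Amb n} (hf : IsHypersurface f) (hN : IsGaussMap f N)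
    {p : M} {w : Amb n} (hw : ∀ i : Fin n, ⟪partialDeriv f p i, w⟫_ℝ = 0) (hwN : ⟪N p, w⟫_ℝ = 0) :
    w = 0 := by
  have hN0 : N p ≠ 0 := norm_ne_zero_iff.1 (by simp [hN.norm_eq_one p])
  -- A tangent normal vector would be orthogonal to itself.
  have hnot : N p ∉ Submodule.span ℝ (Set.range fun i : Fin n => partialDeriv f p i) := by
    intro hmem
    have hle : Submodule.span ℝ (Set.range fun i : Fin n => partialDeriv f p i) ≤ (ℝ ∙ N p)ᗮ := by
      rw [Submodule.span_le]
      rintro _ ⟨i, rfl⟩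
      exact Submodule.mem_orthogonal_singleton_iff_inner_left.2 (hN.normal p _)
    exact hN0 (inner_self_eq_zero (𝕜 := ℝ).1
      (Submodule.mem_orthogonal_singleton_iff_inner_left.1 (hle hmem)))
  have hli : LinearIndependent ℝ (Fin.cons (N p) (fun i : Fin n => partialDeriv f p i) : Fin (n + 1) → Amb n) :=
    (linearIndependent_partialDeriv hf p).finCons hnot
  have htop := hli.span_eq_top_of_card_eq_finrank' (by simp)
  have hle : Submodule.span ℝ (Set.range (Fin.cons (N p) (fun i : Fin n => partialDeriv f p i) :
      Fin (n + 1) → Amb n)) ≤ (ℝ ∙ w)ᗮ := by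
    rw [Submodule.span_le]
    rintro _ ⟨i, rfl⟩
    refine Submodule.mem_orthogonal_singleton_iff_inner_left.2 ?_
    refine Fin.cases ?_ (fun j => ?_) i
    · simpa using hwN
    · simpa using hw j
  rw [htop] at hle
  exact inner_self_eq_zero (𝕜 := ℝ).1
    (Submodule.mem_orthogonal_singleton_iff_inner_left.1 (hle (Submodule.mem_top (x := w))))

/-- The surface gradient of a height function is the tangential part of its direction. -/
theorem surfGrad_inner_const {f N : M → Amb n} (hf : IsHypersurface f) (hN : IsGaussMap f N)
    (η : Amb n) (p : M) :
    surfGrad f (fun q => ⟪f q, η⟫_ℝ) p = η - ⟪η, N p⟫_ℝ • N p := by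
  have hfd : MDifferentiableAt (𝓡∂ n) 𝓘(ℝ, Amb n) f p :=
    (hf.smooth p).mdifferentiableAt (by simp)
  have hnormal : ∀ i, ⟪partialDeriv f p i, N p⟫_ℝ = 0 := fun i => hN.normal p _
  have hnormal' : ∀ i, ⟪N p, partialDeriv f p i⟫_ℝ = 0 := fun i => by
    rw [real_inner_comm, hnormal]
  rw [← sub_eq_zero]
  -- Both sides are tested against the coordinate vectors, where `g g⁻¹ = 1` collapses the double
  -- sum, and against `N`.
  refine eq_zero_of_inner_eq_zero hf hN (p := p) (fun k => ?_) ?_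
  · have hinv : gram f p * (gram f p)⁻¹ = 1 := Matrix.mul_nonsing_inv _ (isUnit_det_gram hf p)
    have hsum : ⟪partialDeriv f p k, surfGrad f (fun q => ⟪f q, η⟫_ℝ) p⟫_ℝ =
        ⟪partialDeriv f p k, η⟫_ℝ := by
      calc ⟪partialDeriv f p k, surfGrad f (fun q => ⟪f q, η⟫_ℝ) p⟫_ℝ
          = ∑ j, (gram f p * (gram f p)⁻¹) k j * ⟪partialDeriv f p j, η⟫_ℝ := by
            simp only [surfGrad, inner_sum, real_inner_smul_right, Matrix.mul_apply,
              Finset.sum_mul, partialDeriv_inner_const hfd]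
            rw [Finset.sum_comm]
            refine Finset.sum_congr rfl fun j _ => Finset.sum_congr rfl fun i _ => ?_
            simp only [gram, Matrix.of_apply]
            ring
        _ = ⟪partialDeriv f p k, η⟫_ℝ := by simp [hinv, Matrix.one_apply]
    rw [inner_sub_right, inner_sub_right, hsum, real_inner_smul_right, hnormal]
    simp
  · simp only [surfGrad, inner_sub_right, inner_sum, real_inner_smul_right, hnormal',
      real_inner_self_eq_norm_sq, hN.norm_eq_one, real_inner_comm η (N p)]
    simp

/-- On a `ψ`-minimal hypersurface, the `ψ`-Laplacian of the height `⟨·, η⟩` is `⟨∇ψ, η⟩`. -/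
theorem weightedLaplacian_inner_const {ψ : Amb n → ℝ} {f N : M → Amb n} (hf : IsHypersurface f)
    (hN : IsGaussMap f N) (hmin : IsWeightedMinimal ψ f N) (η : Amb n) (p : M) :
    weightedLaplacian ψ f (fun q => ⟪f q, η⟫_ℝ) p = ⟪gradient ψ (f p), η⟫_ℝ := by
  have hNd : MDifferentiableAt (𝓡∂ n) 𝓘(ℝ, Amb n) N p :=
    (hN.smooth p).mdifferentiableAt (by simp)
  have hnormal : ∀ i, ⟪N p, partialDeriv f p i⟫_ℝ = 0 := fun i => by
    rw [real_inner_comm]; exact hN.normal p _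
  have hgrad : surfGrad f (fun q => ⟪f q, η⟫_ℝ) = fun q => η - ⟪η, N q⟫_ℝ • N q :=
    funext (surfGrad_inner_const hf hN η)
  -- Differentiating the coefficient `⟪η, N⟫` yields multiples of `N`, which the tangential trace
  -- kills.
  have hdiv : surfDiv f (fun q => η - ⟪η, N q⟫_ℝ • N q) p = -(⟪η, N p⟫_ℝ * surfDiv f N p) := by
    simp only [surfDiv, partialDeriv_tangential hNd, inner_neg_left, inner_add_left,
      real_inner_smul_left, hnormal, Finset.mul_sum, ← Finset.sum_neg_distrib]
    refine Finset.sum_congr rfl fun i _ => Finset.sum_congr rfl fun j _ => ?_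
    ring
  have hH : surfDiv f N p + ⟪gradient ψ (f p), N p⟫_ℝ = 0 := neg_eq_zero.1 (hmin p)
  rw [weightedLaplacian, hgrad, weightedDiv, hdiv, inner_sub_right, real_inner_smul_right]
  linear_combination -⟪η, N p⟫_ℝ * hH

theorem weightedLaplacian_const (ψ : Amb n → ℝ) (f : M → Amb n) (a : ℝ) (p : M) :
    weightedLaplacian ψ f (fun _ => a) p = 0 := by
  have hgrad : surfGrad f (fun _ : M => a) = fun _ => 0 := by
    funext q
    simp [surfGrad, partialDeriv_const]
  simp [weightedLaplacian, weightedDiv, surfDiv, hgrad, partialDeriv_const]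

/-- The derivative of the height `⟨·, η⟩` in the direction of the inner conormal `ν` is `⟨η, ν⟩`. -/
theorem inner_surfGrad_inner_const_conormal {f N : M → Amb n} (hf : IsHypersurface f)
    (hN : IsGaussMap f N) (η : Amb n) {p : M} {ν : Amb n} (hν : IsInnerConormal f p ν) :
    ⟪surfGrad f (fun q => ⟪f q, η⟫_ℝ) p, ν⟫_ℝ = ⟪η, ν⟫_ℝ := by
  -- Only the tangency of `ν` matters: it removes the normal part of `η`.
  obtain ⟨-, ⟨v, -, rfl⟩, -⟩ := hν
  rw [surfGrad_inner_const hf hN, inner_sub_left, real_inner_smul_left, real_inner_comm _ (N p),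
    hN.normal, mul_zero, sub_zero]

end Surface

end WeightedHypersurface

open WeightedHypersurface in
theorem proposition3p11 {n : ℕ} [NeZero n]
    -- the radial weight
    (δ : ℝ → ℝ) (hδ : ContDiffOn ℝ 1 δ (Set.Ici 0)) (hδ_anti : AntitoneOn δ (Set.Ici 0))
    (hδ_zero : derivWithin δ (Set.Ici 0) 0 = 0)
    -- the two-sided connected hypersurface, possibly with boundary
    {M : Type*} [TopologicalSpace M] [T2Space M] [SecondCountableTopology M] [ConnectedSpace M]
    [ChartedSpace (EuclideanHalfSpace n) M] [IsManifold (𝓡∂ n) ∞ M]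
    (f N : M → Amb n) (hf : IsHypersurface f) (hN : IsGaussMap f N)
    (h_parabolic : IsWeightedParabolic (radial δ) f)
    (h_minimal : IsWeightedMinimal (radial δ) f N)
    -- the half-space
    (η : Amb n) (hη : ‖η‖ = 1) (c : ℝ) (h_zero : (0 : Amb n) ∈ frontier (closedHalfSpace η c))
    (h_sub : Set.range f ⊆ closedHalfSpace η c)
    (h_bdry : ∀ p ∈ (𝓡∂ n).boundary M, ∀ ν : Amb n, IsInnerConormal f p ν → 0 ≤ ⟪η, ν⟫_ℝ) :
    (∃ a : ℝ, Set.range f ⊆ hyperplane η a) ∧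
    ((∃ p q : M, radial δ (f p) ≠ radial δ (f q)) →
      Set.range f ⊆ frontier (closedHalfSpace η c)) := by
  rw [frontier_closedHalfSpace hη] at h_zero ⊢
  obtain rfl : c = 0 := by simpa [hyperplane, eq_comm] using h_zero
  have hle : ∀ p, ⟪f p, η⟫_ℝ ≤ 0 := fun p => h_sub (Set.mem_range_self p)
  have hlap := weightedLaplacian_inner_const hf hN h_minimal η
  have hsmooth : ContMDiff (𝓡∂ n) 𝓘(ℝ, ℝ) 2 (fun q => ⟪f q, η⟫_ℝ) := by
    have h := (innerSL ℝ η).contMDiff.comp (hf.smooth.of_le (m := 2) (WithTop.coe_le_coe.2 le_top))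
    simpa only [Function.comp_def, innerSL_apply_apply, real_inner_comm] using h
  obtain ⟨a, ha⟩ := h_parabolic (fun q => ⟪f q, η⟫_ℝ) hsmooth
    ⟨0, by rintro _ ⟨p, rfl⟩; exact hle p⟩
    (fun p _ => by
      rw [hlap]
      exact inner_gradient_radial_nonneg hδ hδ_anti hδ_zero (hle p))
    (fun p hp ν hν => by
      rw [inner_surfGrad_inner_const_conormal hf hN η hν]
      exact h_bdry p hp ν hν)
  refine ⟨⟨a, by rintro _ ⟨p, rfl⟩; exact ha p⟩, ?_⟩
  rintro ⟨p, q, hpq⟩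
  obtain rfl | ha0 := eq_or_ne a 0
  · rintro _ ⟨p, rfl⟩
    exact ha p
  · refine absurd ?_ hpq
    have h0 : ∀ p, f p ≠ 0 := fun p hp => ha0 (by simpa [hp] using (ha p).symm)
    refine radial_eq_of_deriv_eq_zero hδ hf.smooth.continuous h0 (fun r => ?_) p q
    have h := hlap r
    rw [funext ha, weightedLaplacian_const, (hasGradientAt_radial_of_ne_zero hδ (h0 r)).gradient,
      real_inner_smul_left, ha r] at h
    simpa [ha0, h0 r] using h.symm
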